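/- Let $(c_0)_p = \{(x_n) \in \mathbb{R}^{\mathbb{N}} : x_n \to 0\}$ be the real vector space of all real sequences converging to zero, endowed with the topology induced from the product topology of $\mathbb{R}^{\mathbb{N}}$ (the topology of pointwise convergence). Then there exists an infinite-dimensional linear subspace $F$ of $(c_0)_p$ that is closed in $(c_0)_p$ and that, with the subspace topology, is not isomorphic to $(c_0)_p$ as a topological vector space; that is, there is no linear homeomorphism from $F$ onto $(c_0)_p$. -/

import Mathlib

open Filter Topology

/-- The space `(c₀)ₚ`: all real sequences converging to zero, as a linear subspace of `ℝ^ℕ`.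
Coerced to a type it carries the subspace topology inherited from the product topology of
`ℕ → ℝ`, that is, the topology of pointwise convergence. -/
def c0p : Submodule ℝ (ℕ → ℝ) where
  carrier := {x | Tendsto x atTop (𝓝 0)}
  add_mem' := by
    intro x y hx hy
    change Tendsto (fun n => x n + y n) atTop (𝓝 0)
    have hx : Tendsto x atTop (𝓝 0) := hx
    have hy : Tendsto y atTop (𝓝 0) := hy
    simpa using hx.add hy
  zero_mem' := tendsto_const_nhds
  smul_mem' := by
    intro c x hx
    change Tendsto (fun n => c * x n) atTop (𝓝 0)
    have hx : Tendsto x atTop (𝓝 0) := hx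
    simpa using hx.const_mul c

/-!
The subspace `F` is a `c₀`-sum of the spaces `ℓ₁ⁿ⁺¹`. Each `ℓ₁ⁿ⁺¹` embeds isometrically into
`ℓ_∞` of its `2ⁿ⁺¹` sign tuples, by sending `a` to its signed sums `∑ i, ± a i`, so after listing
all pairs `(n, ε)` of a block number and a sign tuple, `F` is the set of null sequences whose
`n`-th block consists of the signed sums of some `a`. Since `a` can be read off from finitely many
coordinates, `F` is cut out by continuous functionals and is closed (`isClosed_signSumSubspace`).

A linear homeomorphism `T : F → (c₀)ₚ` is ruled out by the cotype of `ℓ₁`, the dual of `c₀`.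
Pull the coordinates `a n i` back to functionals `φ n i` on `(c₀)ₚ`. Continuity for pointwise
convergence makes them finitely supported (`exists_finset_eq_sum`). The signed sums of
`φ n 0, …, φ n n` are the coordinates of `T⁻¹`, hence bounded in `ℓ₁` by one constant `C`
(`exists_sum_abs_le_of_pointwise_bounded`, by Banach–Steinhaus on `c₀`). Khinchin's inequality
(`khinchin_lower`) then gives, in each block, an index `i n` for which `φ n (i n)` has `ℓ₁` norm at
most `2 C / √(n + 1)` (`exists_sum_abs_le_of_sign_sums_le`). But `F` contains a sequence whose
`(n, i n)` coefficient is `(n + 1)^(-1/4)`; its image under `T` is a bounded sequence, on which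
`φ n (i n)` takes that value, which is too large for big `n`.
-/

/-! ### Khinchin's inequality and cotype two of `ℓ₁` -/

/-- The real sign `±1` encoded by a boolean. -/
def boolSign (b : Bool) : ℝ := if b then 1 else -1

theorem abs_boolSign (b : Bool) : |boolSign b| = 1 := by
  cases b <;> simp [boolSign]

theorem sum_bool_tuple_succ {n : ℕ} (f : (Fin (n + 1) → Bool) → ℝ) :
    ∑ ε, f ε = ∑ ε : Fin n → Bool, (f (Fin.cons true ε) + f (Fin.cons false ε)) := by
  rw [← (Fin.consEquiv fun _ => Bool).sum_comp, Fintype.sum_prod_type]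
  simp [Fin.consEquiv, Finset.sum_add_distrib]

theorem sum_sign_sum_sq (n : ℕ) (a : Fin n → ℝ) :
    ∑ ε : Fin n → Bool, (∑ i, boolSign (ε i) * a i) ^ 2 = 2 ^ n * ∑ i, a i ^ 2 := by
  induction n with
  | zero => simp
  | succ n ih =>
    have h := ih fun i => a i.succ
    rw [sum_bool_tuple_succ, Fin.sum_univ_succ (fun i => a i ^ 2)]
    calc _ = ∑ ε : Fin n → Bool,
          (2 * (∑ i, boolSign (ε i) * a i.succ) ^ 2 + 2 * a 0 ^ 2) := by
          refine Finset.sum_congr rfl fun ε _ => ?_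
          simp only [Fin.sum_univ_succ, Fin.cons_zero, Fin.cons_succ, boolSign]
          simp
          ring
      _ = _ := by
          rw [Finset.sum_add_distrib, ← Finset.mul_sum, h]
          simp
          ring

theorem sum_sign_sum_pow_four_le (n : ℕ) (a : Fin n → ℝ) :
    ∑ ε : Fin n → Bool, (∑ i, boolSign (ε i) * a i) ^ 4 ≤ 2 ^ n * (3 * (∑ i, a i ^ 2) ^ 2) := by
  induction n with
  | zero => simp
  | succ n ih =>
    have h := ih fun i => a i.succ
    have h2 := sum_sign_sum_sq n fun i => a i.succ
    rw [sum_bool_tuple_succ, Fin.sum_univ_succ (fun i => a i ^ 2)]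
    calc _ = ∑ ε : Fin n → Bool, (2 * (∑ i, boolSign (ε i) * a i.succ) ^ 4
            + 12 * a 0 ^ 2 * (∑ i, boolSign (ε i) * a i.succ) ^ 2 + 2 * a 0 ^ 4) := by
          refine Finset.sum_congr rfl fun ε _ => ?_
          simp only [Fin.sum_univ_succ, Fin.cons_zero, Fin.cons_succ, boolSign]
          simp
          ring
      _ = 2 * ∑ ε : Fin n → Bool, (∑ i, boolSign (ε i) * a i.succ) ^ 4
            + 12 * a 0 ^ 2 * (2 ^ n * ∑ i : Fin n, a i.succ ^ 2) + 2 ^ n * (2 * a 0 ^ 4) := by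
          rw [Finset.sum_add_distrib, Finset.sum_add_distrib, ← Finset.mul_sum, ← Finset.mul_sum, h2]
          simp
      _ ≤ 2 * (2 ^ n * (3 * (∑ i : Fin n, a i.succ ^ 2) ^ 2))
            + 12 * a 0 ^ 2 * (2 ^ n * ∑ i : Fin n, a i.succ ^ 2) + 2 ^ n * (6 * a 0 ^ 4) := by
          have h4 : 0 ≤ a 0 ^ 4 := by positivity
          gcongr
          norm_num
      _ = _ := by ring

/-- A Khinchin inequality: the mean of `|∑ ± a i|` over all signs is at least half the Euclidean
norm `s` of `a`. It follows from the moments of order two and four, since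
`16 s³ |x| ≥ 12 s² x² - x⁴`. -/
theorem khinchin_lower (n : ℕ) (a : Fin n → ℝ) :
    2 ^ n * (√(∑ i, a i ^ 2) / 2) ≤ ∑ ε : Fin n → Bool, |∑ i, boolSign (ε i) * a i| := by
  set s := √(∑ i, a i ^ 2) with hs
  have hss : s ^ 2 = ∑ i, a i ^ 2 := Real.sq_sqrt (Finset.sum_nonneg fun i _ => sq_nonneg _)
  have hs0 : 0 ≤ s := Real.sqrt_nonneg _
  rcases hs0.eq_or_lt with h0 | h0
  · rw [← h0]
    simpa using Finset.sum_nonneg fun ε _ => abs_nonneg _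
  have key : ∀ x : ℝ, 12 * s ^ 2 * x ^ 2 - x ^ 4 ≤ 16 * s ^ 3 * |x| := by
    intro x
    have hx := abs_nonneg x
    have e : 16 * s ^ 3 * |x| - (12 * s ^ 2 * |x| ^ 2 - |x| ^ 4)
        = |x| * ((|x| - 2 * s) ^ 2 * (|x| + 4 * s)) := by ring
    have : 0 ≤ |x| * ((|x| - 2 * s) ^ 2 * (|x| + 4 * s)) := by positivity
    rw [← e] at this
    have e4 : |x| ^ 4 = x ^ 4 := (Even.pow_abs (by decide) x)
    rw [sq_abs, e4] at this
    linarith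
  have hsum := Finset.sum_le_sum fun (ε : Fin n → Bool) (_ : ε ∈ Finset.univ) =>
    key (∑ i, boolSign (ε i) * a i)
  rw [Finset.sum_sub_distrib, ← Finset.mul_sum, ← Finset.mul_sum, sum_sign_sum_sq] at hsum
  have h4 := sum_sign_sum_pow_four_le n a
  rw [← hss] at hsum h4
  have hp : (0 : ℝ) < 2 ^ n := by positivity
  have : 16 * s ^ 3 * (2 ^ n * (s / 2)) ≤
      16 * s ^ 3 * ∑ ε : Fin n → Bool, |∑ i, boolSign (ε i) * a i| := by
    have : 0 ≤ 2 ^ n * s ^ 4 := by positivity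
    nlinarith
  exact le_of_mul_le_mul_left this (by positivity)

/-- Vectors `φ i` in the finite-dimensional `ℓ₁` space over `S` all of whose signed sums have norm
at most `C` cannot all be long: `ℓ₁` has cotype two. -/
theorem exists_sum_abs_le_of_sign_sums_le {n : ℕ} {S : Finset ℕ} (φ : Fin (n + 1) → ℕ → ℝ) {C : ℝ}
    (hC : ∀ ε : Fin (n + 1) → Bool, ∑ k ∈ S, |∑ i, boolSign (ε i) * φ i k| ≤ C) :
    ∃ i, ∑ k ∈ S, |φ i k| ≤ 2 * C / √((n : ℝ) + 1) := by
  by_contra! hcon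
  set r := √((n : ℝ) + 1) with hr
  have hr0 : 0 < r := Real.sqrt_pos.2 (by positivity)
  have hrr : r ^ 2 = (n : ℝ) + 1 := Real.sq_sqrt (by positivity)
  have h1 : ∀ k, ∑ i, |φ i k| ≤ r * √(∑ i, φ i k ^ 2) := by
    intro k
    rw [hr, ← Real.sqrt_mul (by positivity)]
    apply Real.le_sqrt_of_sq_le
    simpa using sq_sum_le_card_mul_sum_sq (s := Finset.univ) (f := fun i => |φ i k|)
  have h2 : ∑ ε : Fin (n + 1) → Bool, ∑ k ∈ S, |∑ i, boolSign (ε i) * φ i k| ≤ 2 ^ (n + 1) * C := by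
    refine (Finset.sum_le_sum fun ε _ => hC ε).trans ?_
    simp
  rw [Finset.sum_comm] at h2
  have h3 := (Finset.sum_le_sum fun k (_ : k ∈ S) =>
    khinchin_lower (n + 1) fun i => φ i k).trans h2
  rw [← Finset.mul_sum, ← Finset.sum_div] at h3
  have h4 : (∑ k ∈ S, √(∑ i, φ i k ^ 2)) / 2 ≤ C := le_of_mul_le_mul_left h3 (by positivity)
  have h5 : ∑ i, ∑ k ∈ S, |φ i k| ≤ r * (2 * C) := by
    rw [Finset.sum_comm]
    refine (Finset.sum_le_sum fun k _ => h1 k).trans ?_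
    rw [← Finset.mul_sum]
    gcongr
    linarith
  have h6 : ∑ _i : Fin (n + 1), 2 * C / r < ∑ i, ∑ k ∈ S, |φ i k| :=
    Finset.sum_lt_sum_of_nonempty Finset.univ_nonempty fun i _ => hcon i
  have h7 : ∑ _i : Fin (n + 1), 2 * C / r = r * (2 * C) := by
    simp only [Finset.sum_const, Finset.card_univ, Fintype.card_fin, nsmul_eq_mul]
    push_cast
    rw [← hrr]
    field_simp
  linarith

/-! ### Continuous functionals on `(c₀)ₚ` -/

/-- The `k`-th coordinate functional on `(c₀)ₚ`. -/
def c0pCoord (k : ℕ) : c0p →L[ℝ] ℝ := (ContinuousLinearMap.proj k).comp c0p.subtypeL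

/-- The sequence `y` with all coordinates outside `S` replaced by zero. -/
def c0pOfFinset (S : Finset ℕ) (y : ℕ → ℝ) : c0p :=
  ⟨fun k => if k ∈ S then y k else 0, by
    change Tendsto _ _ _
    refine tendsto_const_nhds.congr' ?_
    rw [← Nat.cofinite_eq_atTop]
    filter_upwards [S.finite_toSet.compl_mem_cofinite] with k hk
    exact (if_neg hk).symm⟩

/-- The `k`-th unit sequence in `(c₀)ₚ`. -/
def c0pUnit (k : ℕ) : c0p := c0pOfFinset {k} 1

theorem c0pOfFinset_eq_sum (S : Finset ℕ) (y : ℕ → ℝ) :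
    c0pOfFinset S y = ∑ k ∈ S, y k • c0pUnit k := by
  ext j
  simp [c0pOfFinset, c0pUnit]

/-- A functional continuous for pointwise convergence depends on finitely many coordinates. -/
theorem exists_finset_eq_sum (φ : c0p →L[ℝ] ℝ) :
    ∃ S : Finset ℕ, ∀ T, S ⊆ T → ∀ x : c0p, φ x = ∑ k ∈ T, (x : ℕ → ℝ) k * φ (c0pUnit k) := by
  have h : {x : c0p | |φ x| < 1} ∈ 𝓝 (0 : c0p) :=
    (isOpen_lt (by fun_prop) continuous_const).mem_nhds (by simp)
  rw [nhds_subtype_eq_comap, mem_comap] at h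
  obtain ⟨t, ht, hts⟩ := h
  rw [nhds_pi, Filter.mem_pi] at ht
  obtain ⟨I, hI, u, hu, hut⟩ := ht
  refine ⟨hI.toFinset, fun T hT x => ?_⟩
  have hz : ∀ z : c0p, (∀ k ∈ T, (z : ℕ → ℝ) k = 0) → φ z = 0 := by
    intro z hz
    by_contra hne
    have hmem : (φ z)⁻¹ • z ∈ {x : c0p | |φ x| < 1} := by
      apply hts
      apply hut
      intro k hk
      have : (((φ z)⁻¹ • z : c0p) : ℕ → ℝ) k = 0 := by
        simp [hz k (hT (hI.mem_toFinset.2 hk))]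
      rw [this]
      exact mem_of_mem_nhds (hu k)
    simp [hne] at hmem
  have := hz (x - c0pOfFinset T x) fun k hk => by simp [c0pOfFinset, hk]
  rw [map_sub, sub_eq_zero] at this
  rw [this, c0pOfFinset_eq_sum]
  simp

/-- The continuous linear identity map from the Banach space `c₀` to `(c₀)ₚ`. -/
def c0pOfZeroAtInfty : ZeroAtInftyContinuousMap ℕ ℝ →L[ℝ] c0p where
  toFun f := ⟨f, by
    have := f.zero_at_infty'
    rwa [cocompact_eq_cofinite, Nat.cofinite_eq_atTop] at this⟩
  map_add' _ _ := rfl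
  map_smul' _ _ := rfl
  cont := by
    refine Continuous.subtype_mk (continuous_pi fun k => ?_) _
    exact (BoundedContinuousFunction.lipschitz_eval_const k).continuous.comp
      (ZeroAtInftyContinuousMap.isometry_toBCF).continuous

/-- Uniform boundedness: a pointwise bounded family of continuous functionals on `(c₀)ₚ` is bounded
in the `ℓ₁` norm of the coefficients. -/
theorem exists_sum_abs_le_of_pointwise_bounded {ι : Type*} (g : ι → c0p →L[ℝ] ℝ)
    (hg : ∀ x, ∃ C, ∀ j, |g j x| ≤ C) :
    ∃ C, ∀ j, ∀ S : Finset ℕ, ∑ k ∈ S, |g j (c0pUnit k)| ≤ C := by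
  obtain ⟨C, hC⟩ := banach_steinhaus (g := fun j => (g j).comp c0pOfZeroAtInfty)
    fun f => hg (c0pOfZeroAtInfty f)
  refine ⟨C, fun j S => ?_⟩
  set y : ℕ → ℝ := fun k => SignType.sign (g j (c0pUnit k)) with hy
  let f : ZeroAtInftyContinuousMap ℕ ℝ :=
    ⟨⟨(c0pOfFinset S y : ℕ → ℝ), continuous_of_discreteTopology⟩, by
      rw [cocompact_eq_cofinite, Nat.cofinite_eq_atTop]
      exact (c0pOfFinset S y).2⟩
  have hf : c0pOfZeroAtInfty f = c0pOfFinset S y := rfl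
  have hfn : ‖f‖ ≤ 1 := by
    rw [← ZeroAtInftyContinuousMap.norm_toBCF_eq_norm,
      BoundedContinuousFunction.norm_le zero_le_one]
    intro k
    change |if k ∈ S then y k else 0| ≤ 1
    split_ifs
    · rcases lt_trichotomy (g j (c0pUnit k)) 0 with h | h | h <;> simp [hy, h]
    · simp
  calc ∑ k ∈ S, |g j (c0pUnit k)| = g j (c0pOfFinset S y) := by
        rw [c0pOfFinset_eq_sum]
        simp [hy, sign_mul_self]
    _ ≤ ‖((g j).comp c0pOfZeroAtInfty) f‖ := le_abs_self _
    _ ≤ ‖(g j).comp c0pOfZeroAtInfty‖ * ‖f‖ := ContinuousLinearMap.le_opNorm _ _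
    _ ≤ C * 1 := by
        gcongr
        · exact (norm_nonneg _).trans (hC j)
        · exact hC j
    _ = C := mul_one C

theorem exists_abs_le (x : c0p) : ∃ B, ∀ k, |(x : ℕ → ℝ) k| ≤ B := by
  have hx : Tendsto (x : ℕ → ℝ) atTop (𝓝 0) := x.2
  obtain ⟨B, hB⟩ := hx.abs.bddAbove_range
  exact ⟨B, fun k => hB ⟨k, rfl⟩⟩

/-! ### The `c₀`-sum of the spaces `ℓ₁ⁿ⁺¹` -/

/-- An arrangement of all pairs of a block number `n` and a tuple of `n + 1` signs into a single
sequence. -/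
noncomputable def signIndex : (Σ n : ℕ, (Fin (n + 1) → Bool)) ≃ ℕ :=
  Classical.choice (nonempty_equiv_of_countable)

theorem tendsto_signIndex_symm_fst : Tendsto (fun k => (signIndex.symm k).1) atTop atTop := by
  rw [← Nat.cofinite_eq_atTop]
  refine Tendsto.cofinite_of_finite_preimage_singleton fun n => ?_
  refine (Set.finite_range fun ε : Fin (n + 1) → Bool => signIndex ⟨n, ε⟩).subset ?_
  rintro k rfl
  exact ⟨(signIndex.symm k).2, by simp⟩

/-- If the coordinates of `x` in block `n` are the signed sums `∑ i, ± a i`, then this functional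
recovers `a i`: it is half the effect of flipping the `i`-th sign. -/
noncomputable def signCoef (n : ℕ) (i : Fin (n + 1)) : c0p →L[ℝ] ℝ :=
  (2⁻¹ : ℝ) • (c0pCoord (signIndex ⟨n, fun _ => true⟩) -
    c0pCoord (signIndex ⟨n, Function.update (fun _ => true) i false⟩))

/-- The sequences whose coordinates in block `n` are all signed sums `∑ i, ± a i` of some
`a : Fin (n + 1) → ℝ`. As `max |∑ i, ± a i| = ∑ i, |a i|`, this is the `c₀`-sum of the spaces
`ℓ₁ⁿ⁺¹`. -/
noncomputable def signSumSubspace : Submodule ℝ c0p :=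
  ⨅ p : Σ n : ℕ, (Fin (n + 1) → Bool), LinearMap.ker
    (c0pCoord (signIndex p) - ∑ i, boolSign (p.2 i) • signCoef p.1 i : c0p →L[ℝ] ℝ).toLinearMap

theorem mem_signSumSubspace {x : c0p} : x ∈ signSumSubspace ↔
    ∀ n (ε : Fin (n + 1) → Bool),
      c0pCoord (signIndex ⟨n, ε⟩) x = ∑ i, boolSign (ε i) * signCoef n i x := by
  simp [signSumSubspace, Submodule.mem_iInf, sub_eq_zero, Sigma.forall]

theorem isClosed_signSumSubspace : IsClosed (signSumSubspace : Set c0p) := by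
  rw [signSumSubspace, Submodule.coe_iInf]
  exact isClosed_iInter fun p => ContinuousLinearMap.isClosed_ker _

/-- The sequence with block `n` equal to `b n` times the `i n`-th unit vector of `ℓ₁ⁿ⁺¹`. -/
noncomputable def signVec (i : ∀ n, Fin (n + 1)) (b : ℕ → ℝ) (hb : Tendsto b atTop (𝓝 0)) : c0p :=
  ⟨fun k => boolSign ((signIndex.symm k).2 (i _)) * b (signIndex.symm k).1, by
    change Tendsto _ _ _
    rw [tendsto_zero_iff_abs_tendsto_zero]
    simpa [Function.comp_def, abs_mul, abs_boolSign] using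
      (hb.comp tendsto_signIndex_symm_fst).abs⟩

theorem c0pCoord_signVec (i b hb n) (ε : Fin (n + 1) → Bool) :
    c0pCoord (signIndex ⟨n, ε⟩) (signVec i b hb) = boolSign (ε (i n)) * b n := by
  change boolSign ((signIndex.symm (signIndex ⟨n, ε⟩)).2 (i _)) *
    b (signIndex.symm (signIndex ⟨n, ε⟩)).1 = _
  rw [Equiv.symm_apply_apply]

theorem signCoef_signVec (i b hb n j) :
    signCoef n j (signVec i b hb) = if j = i n then b n else 0 := by
  simp only [signCoef, smul_apply, sub_apply,
    c0pCoord_signVec, Function.update_apply, boolSign, eq_comm (a := i n)]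
  split_ifs <;> simp_all
  ring

theorem signVec_mem (i b hb) : signVec i b hb ∈ signSumSubspace := by
  rw [mem_signSumSubspace]
  intro n ε
  simp [c0pCoord_signVec, signCoef_signVec]

theorem not_finiteDimensional_signSumSubspace : ¬ FiniteDimensional ℝ signSumSubspace := by
  intro hfin
  have hb : ∀ m, Tendsto (Pi.single m 1 : ℕ → ℝ) atTop (𝓝 0) := fun m =>
    tendsto_const_nhds.congr' <| by
      filter_upwards [eventually_gt_atTop m] with k hk
      simp [hk.ne']
  let v : ℕ → signSumSubspace := fun m => ⟨signVec (fun _ => 0) _ (hb m), signVec_mem _ _ _⟩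
  have hv : LinearIndependent ℝ v := by
    refine LinearIndependent.of_pairwise_dual_eq_zero_one
      (v := v) (fun n => (signCoef n 0).toLinearMap ∘ₗ signSumSubspace.subtype) ?_ ?_
    · intro n m hnm
      simp [v, signCoef_signVec, hnm]
    · intro n
      simp [v, signCoef_signVec]
  exact not_finite_iff_infinite.2 inferInstance hv.finite

/-! ### The `c₀`-sum is not isomorphic to `(c₀)ₚ` -/

theorem isEmpty_signSumSubspace_equiv : IsEmpty (signSumSubspace ≃L[ℝ] c0p) := by
  refine ⟨fun T => ?_⟩
  let R : c0p →L[ℝ] c0p := signSumSubspace.subtypeL.comp (T.symm : c0p →L[ℝ] signSumSubspace)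
  obtain ⟨C, hC⟩ := exists_sum_abs_le_of_pointwise_bounded (fun j => (c0pCoord j).comp R)
    fun x => exists_abs_le (R x)
  let φ : ∀ n, Fin (n + 1) → c0p →L[ℝ] ℝ := fun n i => (signCoef n i).comp R
  have hφ : ∀ n, ∃ i, ∃ S : Finset ℕ, (∀ x : c0p, φ n i x =
      ∑ k ∈ S, (x : ℕ → ℝ) k * φ n i (c0pUnit k)) ∧
      ∑ k ∈ S, |φ n i (c0pUnit k)| ≤ 2 * C / √((n : ℝ) + 1) := by
    intro n
    choose S hS using fun i => exists_finset_eq_sum (φ n i)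
    have hsigns : ∀ ε : Fin (n + 1) → Bool,
        ∑ k ∈ Finset.univ.biUnion S, |∑ i, boolSign (ε i) * φ n i (c0pUnit k)| ≤ C := by
      intro ε
      -- The signed sum is the `(n, ε)` coordinate of `T⁻¹`, since `T⁻¹` takes values in the subspace.
      refine le_of_eq_of_le (Finset.sum_congr rfl fun k _ => ?_) (hC (signIndex ⟨n, ε⟩) _)
      exact congrArg _ (mem_signSumSubspace.1 (T.symm (c0pUnit k)).2 n ε).symm
    obtain ⟨i, hi⟩ := exists_sum_abs_le_of_sign_sums_le (fun i k => φ n i (c0pUnit k)) hsigns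
    exact ⟨i, _, hS i _ (Finset.subset_biUnion_of_mem S (Finset.mem_univ i)), hi⟩
  choose i S hS hle using hφ
  -- The decay `(n + 1)^(-1/4)` is slow compared with the bound `2 * C / (n + 1)^(1/2)`.
  let q : ℕ → ℝ := fun n => √√((n : ℝ) + 1)
  have hq : Tendsto q atTop atTop :=
    Real.tendsto_sqrt_atTop.comp (Real.tendsto_sqrt_atTop.comp
      (tendsto_atTop_add_const_right _ _ tendsto_natCast_atTop_atTop))
  let a : signSumSubspace := ⟨signVec i _ hq.inv_tendsto_atTop, signVec_mem _ _ _⟩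
  obtain ⟨B, hB⟩ := exists_abs_le (T a)
  have hB0 : 0 ≤ B := (abs_nonneg _).trans (hB 0)
  obtain ⟨n, hn⟩ := (hq.eventually_gt_atTop (B * (2 * C))).exists
  have hq0 : 0 < q n := by positivity
  have hqq : √((n : ℝ) + 1) = q n ^ 2 := (Real.sq_sqrt (Real.sqrt_nonneg _)).symm
  have hval : φ n (i n) (T a) = (q n)⁻¹ := by
    simp [φ, R, a, signCoef_signVec]
  have hbound : (q n)⁻¹ ≤ B * (2 * C / q n ^ 2) := by
    rw [← hval, hS, ← hqq]
    calc _ ≤ ∑ k ∈ S n, B * |φ n (i n) (c0pUnit k)| := by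
          refine Finset.sum_le_sum fun k _ => (le_abs_self _).trans ?_
          rw [abs_mul]
          gcongr
          exact hB k
      _ ≤ _ := by
          rw [← Finset.mul_sum]
          gcongr
          exact hle n
  have : q n ≤ B * (2 * C) := by
    have h := mul_le_mul_of_nonneg_right hbound (sq_nonneg (q n))
    field_simp at h
    linarith
  linarith

theorem mainTheorem5 :
    ∃ F : Submodule ℝ c0p,
      IsClosed (F : Set c0p) ∧ ¬ FiniteDimensional ℝ F ∧ IsEmpty (F ≃L[ℝ] c0p) :=
  ⟨signSumSubspace, isClosed_signSumSubspace, not_finiteDimensional_signSumSubspace,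
    isEmpty_signSumSubspace_equiv⟩
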